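/- A \emph{tree-like tableau} is a Young diagram (left-justified rows of weakly decreasing positive lengths, with rows listed from top to bottom) in which some cells contain a point, such that: (1) the top left cell contains a point, called the root point; (2) for every non-root pointed cell $c$, there is either a pointed cell above $c$ in the same column or a pointed cell to the left of $c$ in the same row, but not both; (3) every row and every column contains at least one pointed cell. The \emph{size} of a tree-like tableau is its number of points, and $\mathcal{T}_n$ denotes the (finite) set of tree-like tableaux of size $n$. A \emph{corner} of a tree-like tableau $T$ is a cell of its diagram, pointed or not, whose bottom and right edges both lie on the southeast border of the diagram. Let $c(T)$ be the number of corners of $T$, and let $c(\mathcal{T}_n)=\sum_{T\in\mathcal{T}_n}c(T)$. \textbf{Theorem.} For every positive integer $n$, $$c(\mathcal{T}_n)=\begin{cases}1,&\text{if } n=1,\\[2pt] n!\cdot\dfrac{n+4}{6},&\text{if } n\ge 2.\end{cases}$$ -/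

import Mathlib

/-- A tree-like tableau: a Young diagram (in English notation, cell `(i, j)` lying in row `i` and
column `j`, both counted from `0`) together with a set of pointed cells.  A `YoungDiagram` is given
by its cells only, so it has no empty rows or columns. -/
@[ext]
structure TreeLikeTableau where
  /-- the underlying diagram -/
  shape : YoungDiagram
  /-- the pointed cells -/
  points : Finset (ℕ × ℕ)
  points_subset : points ⊆ shape.cells
  /-- the top left cell contains a point, the root point -/
  root_mem : (0, 0) ∈ points
  /-- each non-root pointed cell has a pointed cell above it in its column or a pointed cell to its
  left in its row, but not both -/
  parent : ∀ i j : ℕ, (i, j) ∈ points → (i, j) ≠ (0, 0) →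
    Xor (∃ i' < i, (i', j) ∈ points) (∃ j' < j, (i, j') ∈ points)
  /-- every row possesses a pointed cell -/
  row_pointed : ∀ i j : ℕ, (i, j) ∈ shape → ∃ j', (i, j') ∈ points
  /-- every column possesses a pointed cell -/
  col_pointed : ∀ i j : ℕ, (i, j) ∈ shape → ∃ i', (i', j) ∈ points

/-- The corners of a Young diagram: the cells whose bottom and right edges both lie on the
southeast border, i.e. with no cell of the diagram immediately below or immediately to the right. -/
def YoungDiagram.corners (μ : YoungDiagram) : Finset (ℕ × ℕ) :=
  {c ∈ μ.cells | (c.1 + 1, c.2) ∉ μ ∧ (c.1, c.2 + 1) ∉ μ}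

namespace TreeLikeTableau

/-- The size of a tree-like tableau is its number of points. -/
def size (T : TreeLikeTableau) : ℕ := T.points.card

/-- The number `c(T)` of corners of a tree-like tableau. -/
def numCorners (T : TreeLikeTableau) : ℕ := T.shape.corners.card

theorem shape_subset (T : TreeLikeTableau) :
    T.shape.cells ⊆ Finset.range T.size ×ˢ Finset.range T.size := by
  rintro ⟨i, j⟩ h
  have h : (i, j) ∈ T.shape := h
  have h1 : Finset.range (i + 1) ⊆ T.points.image Prod.fst := by
    intro k hk
    obtain ⟨l, hl⟩ := T.row_pointed k j
      (T.shape.up_left_mem (by simpa [Nat.lt_succ_iff] using hk) le_rfl h)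
    exact Finset.mem_image.2 ⟨_, hl, rfl⟩
  have h2 : Finset.range (j + 1) ⊆ T.points.image Prod.snd := by
    intro k hk
    obtain ⟨l, hl⟩ := T.col_pointed i k
      (T.shape.up_left_mem le_rfl (by simpa [Nat.lt_succ_iff] using hk) h)
    exact Finset.mem_image.2 ⟨_, hl, rfl⟩
  have c1 := (Finset.card_le_card h1).trans Finset.card_image_le
  have c2 := (Finset.card_le_card h2).trans Finset.card_image_le
  simp only [Finset.card_range] at c1 c2
  simp only [Finset.mem_product, Finset.mem_range, size]
  exact ⟨c1, c2⟩

theorem finite_size_eq (n : ℕ) : {T : TreeLikeTableau | T.size = n}.Finite := by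
  let B := (Finset.range n ×ˢ Finset.range n).powerset
  refine Set.Finite.of_finite_image (f := fun T => (T.shape.cells, T.points))
    ((B ×ˢ B).finite_toSet.subset ?_) ?_
  · rintro _ ⟨T, rfl, rfl⟩
    simp only [Finset.coe_product, Set.mem_prod, Finset.mem_coe, B, Finset.mem_powerset]
    exact ⟨T.shape_subset, T.points_subset.trans T.shape_subset⟩
  · intro T _ T' _ h
    simp only [Prod.mk.injEq] at h
    exact TreeLikeTableau.ext (YoungDiagram.ext h.1) h.2

/-- The set `𝒯ₙ` of tree-like tableaux of size `n`. -/
noncomputable def ofSize (n : ℕ) : Finset TreeLikeTableau := (finite_size_eq n).toFinset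

/-- The number `c(X)` of corners in a finite set `X` of tree-like tableaux. -/
def totalCorners (X : Finset TreeLikeTableau) : ℕ := ∑ T ∈ X, T.numCorners

end TreeLikeTableau

/-! Deleting the first column of a tableau loses nothing but a letter of the border word: the
deleted points lay exactly in the free rows, those where no remaining point has a point above it. So
tableaux of size `m + 1` correspond to partial tableaux on border words of length `m`
(`ofPartial_injective`, `exists_ofPartial_eq`).

Give a partial tableau the weight `x ^ (number of free rows)`. A new empty bottom row multiplies the
weight polynomial `f(x)` of a border word by `x`. A new first column points a nonempty set of free
rows, of which only the topmost stays free, so `f(x)` becomes `x (f(x+1) - f(x))` by the binomial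
theorem. Summed over both letters this gives `x f(x+1)`, hence total weight `x(x+1)⋯(x+m)`.

A new column creates a corner exactly when the last row was empty. This yields the recurrence
`cornerWeight_succ`, solved in `cornerWeight_add_two`; evaluation at `x = 1` gives the theorem. -/

namespace TreeLikeTableau

open Finset

/-! ### Adding and deleting the first column of a set of cells -/

/-- Shift the cells of `P` one column to the right and put the rows `S` in the first column. -/
def addColumn (S : Finset ℕ) (P : Finset (ℕ × ℕ)) : Finset (ℕ × ℕ) :=
  S.image (fun i => (i, 0)) ∪ P.image (fun c => (c.1, c.2 + 1))

/-- The rows of the cells of `P` in the first column. -/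
def firstColumn (P : Finset (ℕ × ℕ)) : Finset ℕ := {c ∈ P | c.2 = 0}.image Prod.fst

/-- Delete the first column and shift the other cells one column to the left. -/
def dropColumn (P : Finset (ℕ × ℕ)) : Finset (ℕ × ℕ) :=
  {c ∈ P | c.2 ≠ 0}.image (fun c => (c.1, c.2 - 1))

section Columns

variable {S : Finset ℕ} {P : Finset (ℕ × ℕ)} {i j : ℕ}

@[simp] theorem mem_addColumn_zero : (i, 0) ∈ addColumn S P ↔ i ∈ S := by
  simp [addColumn]

@[simp] theorem mem_addColumn_succ : (i, j + 1) ∈ addColumn S P ↔ (i, j) ∈ P := by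
  simp [addColumn]

@[simp] theorem mem_firstColumn : i ∈ firstColumn P ↔ (i, 0) ∈ P := by
  simp [firstColumn]

@[simp] theorem mem_dropColumn : (i, j) ∈ dropColumn P ↔ (i, j + 1) ∈ P := by
  simp only [dropColumn, mem_image, mem_filter, Prod.exists, Prod.mk.injEq]
  constructor
  · rintro ⟨a, b, ⟨h, hb⟩, rfl, rfl⟩
    rwa [Nat.sub_add_cancel (Nat.pos_of_ne_zero hb)]
  · exact fun h => ⟨i, j + 1, ⟨h, by simp⟩, rfl, rfl⟩

@[simp] theorem addColumn_firstColumn_dropColumn (P : Finset (ℕ × ℕ)) :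
    addColumn (firstColumn P) (dropColumn P) = P := by
  ext ⟨i, _ | j⟩ <;> simp

@[simp] theorem firstColumn_addColumn : firstColumn (addColumn S P) = S := by
  ext; simp

@[simp] theorem dropColumn_addColumn : dropColumn (addColumn S P) = P := by
  ext ⟨i, j⟩; simp

theorem card_addColumn : (addColumn S P).card = S.card + P.card := by
  rw [addColumn, card_union_of_disjoint, card_image_of_injective, card_image_of_injective]
  · rintro ⟨a, b⟩ ⟨c, d⟩ h
    simpa using h
  · intro a b h
    simpa using h
  · rw [disjoint_left]
    rintro ⟨a, b⟩ h h'
    simp only [mem_image, Prod.mk.injEq] at h h'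
    obtain ⟨_, _, _, rfl⟩ := h
    obtain ⟨_, _, _, h⟩ := h'
    omega

end Columns

/-! ### Border words

A border word is read from the southwest to the northeast along the border of a diagram: `true` is
the bottom edge of a column, `false` the right edge of a row.  The right edge of the top row, which
ends every border word, is left out. -/

/-- The number of rows, empty ones included, of the diagram with border word `w`. -/
def height : List Bool → ℕ
  | [] => 1
  | true :: w => height w
  | false :: w => height w + 1

/-- The cells of the diagram with border word `w`. -/
def cells : List Bool → Finset (ℕ × ℕ)
  | [] => ∅
  | true :: w => addColumn (range (height w)) (cells w)
  | false :: w => cells w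

/-- The number of corners of the diagram with border word `w`. -/
def cornerCount : List Bool → ℕ
  | [] => 0
  | false :: w => cornerCount w
  | true :: w => cornerCount w + if w.head? = some true then 0 else 1

theorem height_pos : ∀ w, 0 < height w
  | [] => Nat.one_pos
  | true :: w => height_pos w
  | false :: _ => Nat.succ_pos _

theorem lt_height_of_mem_cells : ∀ {w : List Bool} {i j : ℕ}, (i, j) ∈ cells w → i < height w
  | true :: w, i, 0, h => by simpa [cells, height] using h
  | true :: w, i, j + 1, h => lt_height_of_mem_cells (w := w) (j := j) (by simpa [cells] using h)
  | false :: w, i, j, h => (lt_height_of_mem_cells (w := w) h).trans (Nat.lt_succ_self _)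

theorem isLowerSet_cells : ∀ w : List Bool, IsLowerSet (cells w : Set (ℕ × ℕ))
  | [] => by simp [cells, isLowerSet_empty]
  | false :: w => isLowerSet_cells w
  | true :: w => by
    rintro ⟨i, j⟩ ⟨i', j'⟩ ⟨hi, hj⟩ h
    simp only [mem_coe, cells] at h hi hj ⊢
    have hlt : i < height w := lt_height_of_mem_cells (w := true :: w) h
    cases j' with
    | zero => simpa using hi.trans_lt hlt
    | succ j' =>
      cases j with
      | zero => omega
      | succ j =>
        rw [mem_addColumn_succ] at h ⊢
        exact isLowerSet_cells w (show (i', j') ≤ (i, j) from ⟨hi, by simpa using hj⟩) h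

/-- The Young diagram with border word `w`. -/
def diagram (w : List Bool) : YoungDiagram := ⟨cells w, isLowerSet_cells w⟩

theorem mem_diagram {w : List Bool} {c : ℕ × ℕ} : c ∈ diagram w ↔ c ∈ cells w := Iff.rfl

theorem last_row_mem_cells_iff (w : List Bool) :
    (height w - 1, 0) ∈ cells w ↔ w.head? = some true := by
  match w with
  | [] => simp [cells]
  | true :: w => simp [cells, height, height_pos w]
  | false :: w =>
    simp only [cells, height, Nat.add_sub_cancel, List.head?_cons, Option.some.injEq,
      Bool.false_eq_true, iff_false]
    exact fun h => (lt_height_of_mem_cells h).false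

theorem card_corners_diagram : ∀ w : List Bool, (diagram w).corners.card = cornerCount w
  | [] => by simp [YoungDiagram.corners, diagram, cells, cornerCount]
  | false :: w => card_corners_diagram w
  | true :: w => by
    have h : (diagram (true :: w)).corners = addColumn
        (if w.head? = some true then ∅ else {height w - 1}) (diagram w).corners := by
      have hp := height_pos w
      ext ⟨i, _ | j⟩
      · simp only [YoungDiagram.corners, mem_filter, YoungDiagram.mem_cells, mem_diagram, cells,
          mem_addColumn_zero, mem_addColumn_succ, mem_range, ← last_row_mem_cells_iff]
        constructor
        · rintro ⟨h1, h2, h3⟩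
          obtain rfl : i = height w - 1 := by omega
          simp [h3]
        · split_ifs with h
          · simp
          · rw [mem_singleton]
            rintro rfl
            exact ⟨by omega, by omega, h⟩
      · simp [YoungDiagram.corners, mem_diagram, cells]
    rw [h, card_addColumn, card_corners_diagram w, cornerCount, add_comm]
    split_ifs <;> simp

/-- The heights are needed because leading `false` letters are empty rows, invisible in the cells.
-/
theorem cells_injective : ∀ {w w' : List Bool}, height w = height w' → cells w = cells w' →
    w = w'
  | [], [], _, _ => rfl
  | [], true :: w', _, h => by
    have : (0, 0) ∈ cells (true :: w') := by simp [cells, height_pos]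
    rw [← h] at this
    simp [cells] at this
  | true :: w, [], _, h => by
    have : (0, 0) ∈ cells (true :: w) := by simp [cells, height_pos]
    rw [h] at this
    simp [cells] at this
  | [], false :: w', h, _ => absurd h (by have := height_pos w'; simp only [height]; omega)
  | false :: w, [], h, _ => absurd h (by have := height_pos w; simp only [height]; omega)
  | true :: w, true :: w', h, h' => by
    rw [cells_injective (w := w) (w' := w') h (by simpa [cells] using congrArg dropColumn h')]
  | false :: w, false :: w', h, h' => by
    rw [cells_injective (w := w) (w' := w') (Nat.succ_injective h) h']
  | true :: w, false :: w', h, h' => by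
    have := (last_row_mem_cells_iff (true :: w)).2 rfl
    rw [h, h', last_row_mem_cells_iff] at this
    simp at this
  | false :: w, true :: w', h, h' => by
    have := (last_row_mem_cells_iff (true :: w')).2 rfl
    rw [← h, ← h', last_row_mem_cells_iff] at this
    simp at this

theorem exists_cells_eq (r : ℕ) (hr : 0 < r) (C : Finset (ℕ × ℕ))
    (hC : IsLowerSet (C : Set (ℕ × ℕ))) (hrC : ∀ i j, (i, j) ∈ C → i < r) :
    ∃ w, height w = r ∧ cells w = C := by
  -- Each step peels off the first column if the last row is nonempty, and the last row otherwise.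
  induction hm : r + C.card using Nat.strong_induction_on generalizing r C with
  | _ m ih =>
    by_cases hlast : (r - 1, 0) ∈ C
    · have hfirst : firstColumn C = range r := by
        ext i
        simp only [mem_firstColumn, mem_range]
        refine ⟨hrC i 0, fun hi => hC (show (i, 0) ≤ (r - 1, 0) from ⟨?_, le_rfl⟩) hlast⟩
        show i ≤ r - 1
        omega
      have hcard : r + (dropColumn C).card = C.card := by
        conv_rhs => rw [← addColumn_firstColumn_dropColumn C, card_addColumn, hfirst, card_range]
      obtain ⟨w, hw, hw'⟩ := ih (r + (dropColumn C).card) (by omega) r hr (dropColumn C)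
        (by
          rintro ⟨i, j⟩ ⟨i', j'⟩ ⟨hi, hj⟩ h
          simp only [mem_coe, mem_dropColumn] at h hi hj ⊢
          exact hC (show (i', j' + 1) ≤ (i, j + 1) from ⟨hi, Nat.succ_le_succ hj⟩) h)
        (fun i j h => hrC i (j + 1) (mem_dropColumn.1 h)) rfl
      refine ⟨true :: w, hw, ?_⟩
      rw [cells, hw, hw', ← hfirst, addColumn_firstColumn_dropColumn]
    · have hrC' : ∀ i j, (i, j) ∈ C → i < r - 1 := fun i j h => by
        by_contra hi
        exact hlast (hC (show (r - 1, 0) ≤ (i, j) from ⟨not_lt.1 hi, Nat.zero_le _⟩) h)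
      obtain rfl | hr1 := Nat.eq_or_lt_of_le (Nat.succ_le_of_lt hr)
      · refine ⟨[], rfl, ?_⟩
        rw [cells, eq_comm, eq_empty_iff_forall_notMem]
        rintro ⟨i, j⟩ h
        exact absurd (hrC' i j h) (by simp)
      · obtain ⟨w, hw, hw'⟩ := ih (r - 1 + C.card) (by omega) (r - 1) (by omega) C hC hrC' rfl
        exact ⟨false :: w, by rw [height, hw]; omega, hw'⟩

/-! ### Partial tableaux -/

/-- A tree-like tableau without its first column, on the diagram with border word `w`. -/
structure IsPartial (w : List Bool) (P : Finset (ℕ × ℕ)) : Prop where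
  subset : P ⊆ cells w
  col_pointed : ∀ j, (0, j) ∈ cells w → ∃ i, (i, j) ∈ P
  not_left : ∀ i j, (i, j) ∈ P → (∃ i' < i, (i', j) ∈ P) → ∀ j' < j, (i, j') ∉ P

open Classical in
/-- The rows in which no pointed cell has a pointed cell above it. -/
noncomputable def freeRows (w : List Bool) (P : Finset (ℕ × ℕ)) : Finset ℕ :=
  {i ∈ range (height w) | ∀ j, (i, j) ∈ P → ∀ i' < i, (i', j) ∉ P}

theorem mem_freeRows {w : List Bool} {P : Finset (ℕ × ℕ)} {i : ℕ} :
    i ∈ freeRows w P ↔ i < height w ∧ ∀ j, (i, j) ∈ P → ∀ i' < i, (i', j) ∉ P := by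
  simp [freeRows]

open Classical in
/-- The partial tableaux with border word `w`. -/
noncomputable def partials (w : List Bool) : Finset (Finset (ℕ × ℕ)) :=
  {P ∈ (cells w).powerset | IsPartial w P}

theorem mem_partials {w : List Bool} {P : Finset (ℕ × ℕ)} : P ∈ partials w ↔ IsPartial w P := by
  simpa [partials] using IsPartial.subset

/-- A new point lies to the left of every old point in its row, which `not_left` forbids exactly
when one of these has a point above it. -/
theorem isPartial_addColumn {w : List Bool} {S : Finset ℕ} {P : Finset (ℕ × ℕ)} :
    IsPartial (true :: w) (addColumn S P) ↔
      IsPartial w P ∧ S ⊆ freeRows w P ∧ S.Nonempty := by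
  constructor
  · intro h
    refine ⟨⟨fun ⟨i, j⟩ hc => ?_, fun j hj => ?_, fun i j hP ⟨i', hi, hi'⟩ j' hj hj' => ?_⟩,
      fun i hi => mem_freeRows.2 ⟨?_, fun j hj i' hi' hP => ?_⟩, ?_⟩
    · have := h.subset (mem_addColumn_succ.2 hc)
      simpa [cells] using this
    · simpa using h.col_pointed (j + 1) (by simpa [cells] using hj)
    · exact h.not_left i (j + 1) (by simpa) ⟨i', hi, by simpa⟩ (j' + 1) (by omega) (by simpa)
    · have := h.subset (mem_addColumn_zero.2 hi)
      simpa [cells] using this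
    · exact h.not_left i (j + 1) (by simpa) ⟨i', hi', by simpa⟩ 0 (by omega) (by simpa)
    · obtain ⟨i, hi⟩ := h.col_pointed 0 (by simp [cells, height_pos])
      exact ⟨i, by simpa using hi⟩
  · rintro ⟨h, hS, hne⟩
    refine ⟨?_, ?_, ?_⟩
    · rintro ⟨i, _ | j⟩ hc
      · simpa [cells] using (mem_freeRows.1 (hS (mem_addColumn_zero.1 hc))).1
      · simpa [cells] using h.subset (mem_addColumn_succ.1 hc)
    · rintro (_ | j) hj
      · obtain ⟨i, hi⟩ := hne
        exact ⟨i, by simpa⟩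
      · simpa using h.col_pointed j (by simpa [cells] using hj)
    · rintro i (_ | j) hP ⟨i', hi', hP'⟩ j' hj hj'
      · omega
      · rw [mem_addColumn_succ] at hP hP'
        cases j' with
        | zero => exact (mem_freeRows.1 (hS (mem_addColumn_zero.1 hj'))).2 j hP i' hi' hP'
        | succ j' =>
          exact h.not_left i j hP ⟨i', hi', hP'⟩ j' (by omega) (mem_addColumn_succ.1 hj')

theorem freeRows_addColumn {w : List Bool} {S : Finset ℕ} {P : Finset (ℕ × ℕ)}
    (hS : S ⊆ freeRows w P) (hne : S.Nonempty) :
    freeRows (true :: w) (addColumn S P) = insert (S.min' hne) (freeRows w P \ S) := by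
  ext i
  have hm := hS (S.min'_mem hne)
  simp only [mem_insert, mem_sdiff, mem_freeRows, height] at hm ⊢
  constructor
  · rintro ⟨h1, h2⟩
    by_cases hi : i ∈ S
    · left
      by_contra hne'
      exact h2 0 (by simpa) (S.min' hne) (lt_of_le_of_ne (S.min'_le i hi) (Ne.symm hne'))
        (by simpa using S.min'_mem hne)
    · exact Or.inr ⟨⟨h1, fun j hj i' hi' hP => h2 (j + 1) (by simpa) i' hi' (by simpa)⟩, hi⟩
  · rintro (rfl | ⟨⟨h1, h2⟩, h3⟩)
    · refine ⟨hm.1, ?_⟩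
      rintro (_ | j) hj i' hi' hP
      · exact (S.min'_le i' (by simpa using hP)).not_gt hi'
      · exact hm.2 j (by simpa using hj) i' hi' (by simpa using hP)
    · refine ⟨h1, ?_⟩
      rintro (_ | j) hj i' hi' hP
      · exact h3 (by simpa using hj)
      · exact h2 j (by simpa using hj) i' hi' (by simpa using hP)

theorem card_freeRows_addColumn {w : List Bool} {S : Finset ℕ} {P : Finset (ℕ × ℕ)}
    (hS : S ⊆ freeRows w P) (hne : S.Nonempty) :
    (freeRows (true :: w) (addColumn S P)).card = (freeRows w P).card - S.card + 1 := by
  rw [freeRows_addColumn hS hne, card_insert_of_notMem (by simp [S.min'_mem hne]),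
    card_sdiff_of_subset hS]

theorem isPartial_false_cons {w : List Bool} {P : Finset (ℕ × ℕ)} :
    IsPartial (false :: w) P ↔ IsPartial w P :=
  ⟨fun h => ⟨h.1, h.2, h.3⟩, fun h => ⟨h.1, h.2, h.3⟩⟩

theorem IsPartial.freeRows_false_cons {w : List Bool} {P : Finset (ℕ × ℕ)} (h : IsPartial w P) :
    freeRows (false :: w) P = insert (height w) (freeRows w P) := by
  ext i
  simp only [mem_freeRows, mem_insert, height]
  constructor
  · rintro ⟨h1, h2⟩
    by_cases hi : i = height w
    · exact Or.inl hi
    · exact Or.inr ⟨by omega, h2⟩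
  · rintro (rfl | ⟨h1, h2⟩)
    · exact ⟨by omega, fun j hj => absurd (lt_height_of_mem_cells (h.subset hj)) (lt_irrefl _)⟩
    · exact ⟨by omega, h2⟩

theorem IsPartial.card_freeRows_false_cons {w : List Bool} {P : Finset (ℕ × ℕ)}
    (h : IsPartial w P) : (freeRows (false :: w) P).card = (freeRows w P).card + 1 := by
  rw [h.freeRows_false_cons, card_insert_of_notMem]
  simp [mem_freeRows]

/-- Every letter raises the sum by one: `false` adds a free row, while `true` adds `|S|` points and
removes `|S| - 1` free rows. This fixes the size of `ofPartial`. -/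
theorem IsPartial.card_freeRows_add_card : ∀ {w : List Bool} {P : Finset (ℕ × ℕ)},
    IsPartial w P → (freeRows w P).card + P.card = w.length + 1
  | [], P, h => by
    obtain rfl : P = ∅ := subset_empty.1 h.subset
    simp [freeRows, height]
  | false :: w, P, h => by
    have h' := isPartial_false_cons.1 h
    have := h'.card_freeRows_add_card
    rw [h'.card_freeRows_false_cons, List.length_cons]
    omega
  | true :: w, P, h => by
    rw [← addColumn_firstColumn_dropColumn P] at h ⊢
    obtain ⟨h', hS, hne⟩ := isPartial_addColumn.1 h
    have := h'.card_freeRows_add_card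
    have := card_le_card hS
    rw [card_freeRows_addColumn hS hne, card_addColumn, List.length_cons]
    omega

/-! ### Tree-like tableaux and partial tableaux -/

/-- The tree-like tableau obtained from a partial tableau by adding a first column. -/
noncomputable def ofPartial (w : List Bool) (P : Finset (ℕ × ℕ)) (h : IsPartial w P) :
    TreeLikeTableau where
  shape := diagram (true :: w)
  points := addColumn (freeRows w P) P
  points_subset := by
    rintro ⟨i, _ | j⟩ hc
    · simpa [diagram, cells] using (mem_freeRows.1 (mem_addColumn_zero.1 hc)).1
    · simpa [diagram, cells] using h.subset (mem_addColumn_succ.1 hc)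
  root_mem := by simp [mem_freeRows, height_pos]
  parent := by
    rintro i (_ | j) hc hne
    · refine Or.inl ⟨⟨0, Nat.pos_of_ne_zero (by simpa using hne), ?_⟩, by simp⟩
      simp [mem_freeRows, height_pos]
    · rw [mem_addColumn_succ] at hc
      simp only [mem_addColumn_succ]
      by_cases ha : ∃ i' < i, (i', j) ∈ P
      · refine Or.inl ⟨ha, ?_⟩
        obtain ⟨i', hi', hP⟩ := ha
        rintro ⟨_ | j', hj, hj'⟩
        · exact (mem_freeRows.1 (mem_addColumn_zero.1 hj')).2 j hc i' hi' hP
        · exact h.not_left i j hc ⟨i', hi', hP⟩ j' (by omega) (mem_addColumn_succ.1 hj')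
      · refine Or.inr ⟨?_, ha⟩
        by_cases hf : i ∈ freeRows w P
        · exact ⟨0, by omega, by simpa⟩
        · have hi : i < height w := lt_height_of_mem_cells (h.subset hc)
          simp only [mem_freeRows, hi, true_and] at hf
          push Not at hf
          obtain ⟨j', hj', i', hi', hP⟩ := hf
          -- The point `(i, j')` has a point above it, so no point lies to its left; as `(i, j)` has
          -- none above, `j'` must be left of `j`.
          obtain hlt | rfl | hgt := lt_trichotomy j' j
          · exact ⟨j' + 1, by omega, by simpa⟩
          · exact absurd ⟨i', hi', hP⟩ ha
          · exact absurd hc (h.not_left i j' hj' ⟨i', hi', hP⟩ j hgt)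
  row_pointed := by
    intro i j hc
    have hi : i < height w := lt_height_of_mem_cells (w := true :: w) hc
    by_cases hf : i ∈ freeRows w P
    · exact ⟨0, by simpa⟩
    · simp only [mem_freeRows, hi, true_and] at hf
      push Not at hf
      obtain ⟨j', hj', -⟩ := hf
      exact ⟨j' + 1, by simpa⟩
  col_pointed := by
    rintro i (_ | j) hc
    · exact ⟨0, by simp [mem_freeRows, height_pos]⟩
    · have hc' : (i, j) ∈ cells w := by simpa [mem_diagram, cells] using hc
      simpa using h.col_pointed j
        (isLowerSet_cells w (show (0, j) ≤ (i, j) from ⟨Nat.zero_le _, le_rfl⟩) hc')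

theorem size_ofPartial {w : List Bool} {P : Finset (ℕ × ℕ)} (h : IsPartial w P) :
    (ofPartial w P h).size = w.length + 1 := by
  rw [size, ofPartial, card_addColumn, h.card_freeRows_add_card]

theorem numCorners_ofPartial {w : List Bool} {P : Finset (ℕ × ℕ)} (h : IsPartial w P) :
    (ofPartial w P h).numCorners = cornerCount (true :: w) :=
  card_corners_diagram _

theorem ofPartial_injective {w w' : List Bool} {P P' : Finset (ℕ × ℕ)} {h : IsPartial w P}
    {h' : IsPartial w' P'} (he : ofPartial w P h = ofPartial w' P' h') : w = w' ∧ P = P' := by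
  have h1 : cells (true :: w) = cells (true :: w') :=
    congrArg (fun T => T.shape.cells) he
  have h2 : addColumn (freeRows w P) P = addColumn (freeRows w' P') P' := congrArg points he
  refine ⟨cells_injective ?_ ?_, ?_⟩
  -- The added first column is full, so its length recovers the height.
  · simpa [cells] using congrArg (fun C => (firstColumn C).card) h1
  · simpa [cells] using congrArg dropColumn h1
  · simpa using congrArg dropColumn h2

theorem exists_ofPartial_eq (T : TreeLikeTableau) :
    ∃ (w : List Bool) (P : Finset (ℕ × ℕ)) (h : IsPartial w P), ofPartial w P h = T := by
  have hroot : (0, 0) ∈ T.shape := T.points_subset T.root_mem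
  have hr : 0 < T.shape.colLen 0 := YoungDiagram.mem_iff_lt_colLen.1 hroot
  obtain ⟨w, hw, hw'⟩ := exists_cells_eq (T.shape.colLen 0) hr (dropColumn T.shape.cells)
    (by
      rintro ⟨i, j⟩ ⟨i', j'⟩ ⟨hi, hj⟩ h
      simp only [mem_coe, mem_dropColumn] at h hi hj ⊢
      exact T.shape.up_left_mem hi (Nat.succ_le_succ hj) h)
    (fun i j h => YoungDiagram.mem_iff_lt_colLen.1
      (T.shape.up_left_mem le_rfl (Nat.zero_le _) (mem_dropColumn.1 h)))
  have hshape : cells (true :: w) = T.shape.cells := by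
    rw [cells, hw, hw', ← addColumn_firstColumn_dropColumn T.shape.cells]
    congr 1
    · ext i
      simp [YoungDiagram.mem_iff_lt_colLen]
    · simp
  have hP : IsPartial w (dropColumn T.points) := by
    refine ⟨?_, ?_, ?_⟩
    · rintro ⟨i, j⟩ h
      rw [hw', mem_dropColumn]
      exact T.points_subset (mem_dropColumn.1 h)
    · intro j hj
      rw [hw', mem_dropColumn] at hj
      simpa using T.col_pointed 0 (j + 1) hj
    · rintro i j h ⟨i', hi', ha⟩ j' hj' hl
      rw [mem_dropColumn] at h ha hl
      rcases T.parent i (j + 1) h (by simp) with h' | h'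
      · exact h'.2 ⟨j' + 1, by omega, hl⟩
      · exact h'.2 ⟨i', hi', ha⟩
  refine ⟨w, _, hP, TreeLikeTableau.ext (YoungDiagram.ext hshape) ?_⟩
  show addColumn (freeRows w (dropColumn T.points)) (dropColumn T.points) = T.points
  conv_rhs => rw [← addColumn_firstColumn_dropColumn T.points]
  congr 1
  ext i
  rw [mem_firstColumn, mem_freeRows, hw, ← YoungDiagram.mem_iff_lt_colLen]
  simp only [mem_dropColumn]
  constructor
  · rintro ⟨hi, hfree⟩
    have hex := T.row_pointed i 0 hi
    classical
    -- The leftmost point of a free row has no parent to its left, and none above unless it is in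
    -- the first column; so it is there.
    have hspec := Nat.find_spec hex
    have hmin := fun j' => Nat.find_min (m := j') hex
    generalize Nat.find hex = j at hspec hmin
    cases j with
    | zero => exact hspec
    | succ j =>
      rcases T.parent i (j + 1) hspec (by simp) with ⟨⟨i', hi', ha⟩, -⟩ | ⟨⟨j', hj', hl⟩, -⟩
      · exact absurd ha (hfree j hspec i' hi')
      · exact absurd hl (hmin j' hj')
  · intro hi
    refine ⟨T.points_subset hi, fun j hj i' hi' ha => ?_⟩
    rcases T.parent i (j + 1) hj (by simp) with hp | hp
    · exact hp.2 ⟨0, by omega, hi⟩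
    · exact hp.2 ⟨_, hi', ha⟩

/-! ### Enumeration -/

/-- The words of length `m`. -/
def words : ℕ → Finset (List Bool)
  | 0 => {[]}
  | m + 1 => (words m).image (List.cons true) ∪ (words m).image (List.cons false)

theorem mem_words {m : ℕ} {w : List Bool} : w ∈ words m ↔ w.length = m := by
  induction m generalizing w with
  | zero => simp [words]
  | succ m ih => rcases w with _ | ⟨_ | _, w⟩ <;> simp [words, ih]

theorem sum_words_succ (m : ℕ) (f : List Bool → ℚ) :
    ∑ w ∈ words (m + 1), f w = ∑ w ∈ words m, (f (true :: w) + f (false :: w)) := by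
  rw [words, sum_union, sum_image, sum_image, sum_add_distrib]
  · simp
  · simp
  · rw [disjoint_left]
    simp only [mem_image]
    rintro _ ⟨w, -, rfl⟩ ⟨w', -, h⟩
    simp at h

/-- The partial tableaux with border word `w` counted with weight `x` for each free row. -/
noncomputable def weight (w : List Bool) (x : ℚ) : ℚ :=
  ∑ P ∈ partials w, x ^ (freeRows w P).card

theorem weight_nil (x : ℚ) : weight [] x = x := by
  have : partials [] = {∅} := by
    ext P
    rw [mem_partials, mem_singleton]
    refine ⟨fun h => subset_empty.1 h.subset, ?_⟩
    rintro rfl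
    exact ⟨by simp, by simp [cells], by simp⟩
  rw [weight, this]
  simp [freeRows, height]

theorem weight_false_cons (w : List Bool) (x : ℚ) : weight (false :: w) x = x * weight w x := by
  have : partials (false :: w) = partials w := by
    ext P
    rw [mem_partials, mem_partials, isPartial_false_cons]
  rw [weight, weight, this, mul_sum]
  refine sum_congr rfl fun P hP => ?_
  rw [(mem_partials.1 hP).card_freeRows_false_cons, pow_succ']

theorem weight_true_cons (w : List Bool) (x : ℚ) :
    weight (true :: w) x = x * (weight w (x + 1) - weight w x) := by
  have h : weight (true :: w) x = ∑ P ∈ partials w, ∑ S ∈ (freeRows w P).powerset.erase ∅,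
      x ^ ((freeRows w P).card - S.card + 1) := by
    rw [weight, sum_sigma']
    have key : ∀ a : (_ : Finset (ℕ × ℕ)) × Finset ℕ,
        a ∈ (partials w).sigma (fun P => (freeRows w P).powerset.erase ∅) ↔
          IsPartial (true :: w) (addColumn a.2 a.1) := by
      rintro ⟨P, S⟩
      rw [isPartial_addColumn]
      simp only [mem_sigma, mem_partials, mem_erase, mem_powerset, nonempty_iff_ne_empty]
      tauto
    refine sum_bij' (fun P _ => ⟨dropColumn P, firstColumn P⟩) (fun a _ => addColumn a.2 a.1)
      ?_ ?_ ?_ ?_ ?_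
    · intro P hP
      rw [key]
      simpa using mem_partials.1 hP
    · intro a ha
      exact mem_partials.2 ((key a).1 ha)
    · simp
    · simp
    · intro P hP
      have hP' := mem_partials.1 hP
      rw [← addColumn_firstColumn_dropColumn P] at hP'
      obtain ⟨-, hS, hne⟩ := isPartial_addColumn.1 hP'
      have := card_freeRows_addColumn hS hne
      rw [addColumn_firstColumn_dropColumn] at this
      rw [this]
  rw [h, weight, weight, ← sum_sub_distrib, mul_sum]
  refine sum_congr rfl fun P _ => ?_
  -- Binomial theorem over subsets of the free rows; the term `S = ∅` is the subtracted power of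
  -- `x`.
  have hb := sum_pow_mul_eq_add_pow 1 x (freeRows w P)
  rw [← add_sum_erase _ _ (empty_mem_powerset _)] at hb
  simp only [one_pow, one_mul, card_empty, Nat.sub_zero] at hb
  rw [add_comm x 1, ← hb, add_sub_cancel_left, mul_sum]
  exact sum_congr rfl fun S _ => pow_succ' _ _

/-- The total weight of the partial tableaux with border word of length `m`. -/
noncomputable def totalWeight (m : ℕ) (x : ℚ) : ℚ := ∑ w ∈ words m, weight w x

/-- The total weight of the partial tableaux with border word of length `m` and empty last row. -/
noncomputable def emptyRowWeight (m : ℕ) (x : ℚ) : ℚ :=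
  ∑ w ∈ words m, (if w.head? = some true then 0 else 1) * weight w x

/-- The total weight of the corners of the partial tableaux with border word of length `m`. -/
noncomputable def cornerWeight (m : ℕ) (x : ℚ) : ℚ :=
  ∑ w ∈ words m, (cornerCount w : ℚ) * weight w x

/-! ### Recurrences in the word length and closed forms -/

theorem totalWeight_succ (m : ℕ) (x : ℚ) :
    totalWeight (m + 1) x = x * totalWeight m (x + 1) := by
  rw [totalWeight, totalWeight, sum_words_succ, mul_sum]
  refine sum_congr rfl fun w _ => ?_
  rw [weight_true_cons, weight_false_cons]
  ring

theorem totalWeight_succ' (m : ℕ) (x : ℚ) :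
    totalWeight (m + 1) x = (x + m + 1) * totalWeight m x := by
  induction m generalizing x with
  | zero =>
    rw [totalWeight_succ]
    simp only [totalWeight, words, sum_singleton, weight_nil]
    push_cast
    ring
  | succ m ih =>
    rw [totalWeight_succ, ih, totalWeight_succ m x]
    push_cast
    ring

theorem totalWeight_one (m : ℕ) : totalWeight m 1 = (m + 1).factorial := by
  induction m with
  | zero => simp [totalWeight, words, weight_nil]
  | succ m ih =>
    rw [totalWeight_succ', ih, Nat.factorial_succ (m + 1)]
    push_cast
    ring

theorem emptyRowWeight_zero (x : ℚ) : emptyRowWeight 0 x = x := by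
  simp [emptyRowWeight, words, weight_nil]

/-- Only words beginning with `false` contribute. The empty word also has an empty last row, so
length `0` is separate. -/
theorem emptyRowWeight_succ (m : ℕ) (x : ℚ) :
    emptyRowWeight (m + 1) x = x * totalWeight m x := by
  rw [emptyRowWeight, totalWeight, sum_words_succ, mul_sum]
  refine sum_congr rfl fun w _ => ?_
  simp [weight_false_cons]

theorem cornerWeight_zero (x : ℚ) : cornerWeight 0 x = 0 := by
  simp [cornerWeight, words, cornerCount]

theorem cornerWeight_succ (m : ℕ) (x : ℚ) :
    cornerWeight (m + 1) x = x * cornerWeight m (x + 1) +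
      x * (emptyRowWeight m (x + 1) - emptyRowWeight m x) := by
  simp only [cornerWeight, emptyRowWeight]
  rw [sum_words_succ, ← sum_sub_distrib, mul_sum, mul_sum, ← sum_add_distrib]
  refine sum_congr rfl fun w _ => ?_
  rw [weight_true_cons, weight_false_cons, cornerCount, cornerCount]
  push_cast
  ring

theorem cornerWeight_one (x : ℚ) : cornerWeight 1 x = x := by
  simp [cornerWeight_succ, cornerWeight_zero, emptyRowWeight_zero]

/-- By the two recurrences for `totalWeight` every term is a multiple of `totalWeight (m + 1) x`,
and the cofactors satisfy `A (m + 1) x = A m (x + 1) + (m + 3) x + m + 2`. -/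
theorem cornerWeight_add_two (m : ℕ) (x : ℚ) :
    cornerWeight (m + 2) x =
      totalWeight m x * ((m + 2) * (m + 3) / 2 * x + (m + 1) * (m + 2) * (m + 6) / 6) := by
  induction m generalizing x with
  | zero =>
    simp [cornerWeight_succ (0 + 1), cornerWeight_one, emptyRowWeight_succ, totalWeight, words,
      weight_nil]
    ring
  | succ m ih =>
    have h := totalWeight_succ m x
    have h1 := totalWeight_succ (m + 1) x
    have h2 := totalWeight_succ' (m + 1) x
    rw [cornerWeight_succ, ih, emptyRowWeight_succ, emptyRowWeight_succ]
    push_cast at h2 ⊢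
    linear_combination (-((m + 2) * (m + 3) / 2 * (x + 1) + (m + 1) * (m + 2) * (m + 6) / 6)) * h
      - (x + 1) * h1 + (x + 1) * h2

/-- The restored first column is one more `true`; `emptyRowWeight` counts the corner it may create.
-/
theorem totalCorners_ofSize_succ (m : ℕ) :
    (totalCorners (ofSize (m + 1)) : ℚ) = cornerWeight m 1 + emptyRowWeight m 1 := by
  have h : totalCorners (ofSize (m + 1)) =
      ∑ w ∈ words m, ∑ _P ∈ partials w, cornerCount (true :: w) := by
    rw [totalCorners, sum_sigma', eq_comm]
    have hp : ∀ a : (_ : List Bool) × Finset (ℕ × ℕ), a ∈ (words m).sigma partials →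
        IsPartial a.1 a.2 := fun a ha => mem_partials.1 (mem_sigma.1 ha).2
    refine sum_bij (fun a ha => ofPartial a.1 a.2 (hp a ha)) ?_ ?_ ?_ ?_
    · intro a ha
      simp only [ofSize, Set.Finite.mem_toFinset, Set.mem_ofPred_eq]
      rw [size_ofPartial, mem_words.1 (mem_sigma.1 ha).1]
    · rintro ⟨w, P⟩ _ ⟨w', P'⟩ _ he
      obtain ⟨rfl, rfl⟩ := ofPartial_injective he
      rfl
    · intro T hT
      simp only [ofSize, Set.Finite.mem_toFinset, Set.mem_ofPred_eq] at hT
      obtain ⟨w, P, hP, rfl⟩ := exists_ofPartial_eq T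
      rw [size_ofPartial, Nat.add_right_cancel_iff] at hT
      exact ⟨⟨w, P⟩, mem_sigma.2 ⟨mem_words.2 hT, mem_partials.2 hP⟩, rfl⟩
    · intro a ha
      exact (numCorners_ofPartial _).symm
  rw [h, cornerWeight, emptyRowWeight, ← sum_add_distrib]
  push_cast
  refine sum_congr rfl fun w _ => ?_
  rw [sum_const, weight, cornerCount]
  simp only [one_pow, sum_const, nsmul_eq_mul, mul_one]
  push_cast
  ring

end TreeLikeTableau

theorem mainTheorem1 :
    TreeLikeTableau.totalCorners (TreeLikeTableau.ofSize 1) = 1 ∧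
      ∀ n : ℕ, 2 ≤ n →
        (TreeLikeTableau.totalCorners (TreeLikeTableau.ofSize n) : ℚ) =
          (n.factorial : ℚ) * ((n : ℚ) + 4) / 6 := by
  open TreeLikeTableau in
  constructor
  · have h := totalCorners_ofSize_succ 0
    rw [cornerWeight_zero, emptyRowWeight_zero, zero_add] at h
    exact_mod_cast h
  · intro n hn
    obtain ⟨m, rfl⟩ := Nat.exists_eq_add_of_le' hn
    rw [show m + 2 = (m + 1) + 1 from rfl, totalCorners_ofSize_succ, emptyRowWeight_succ,
      totalWeight_one]
    cases m with
    | zero =>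
      rw [zero_add, cornerWeight_one]
      norm_num [Nat.factorial]
    | succ m =>
      rw [cornerWeight_add_two, totalWeight_one, Nat.factorial_succ (m + 1 + 1),
        Nat.factorial_succ (m + 1)]
      push_cast
      ring
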